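/- Fix $\sigma_e^2>0$. For each $N$ let $\phi_{N,1},\dots,\phi_{N,N}$ be independent Gaussian random variables with mean $0$ and variance $\sigma_e^2$ (the phase errors of $N$ equal-amplitude radios; for different $N$ they may live on different probability spaces), and let $$G_N=\frac1N\Bigl|\sum_{n=1}^N e^{j\phi_{N,n}}\Bigr|^2$$ be the beamforming gain, where $j=\sqrt{-1}$. Put $$\mu_N=1+(N-1)e^{-\sigma_e^2},\qquad s_N^2=\frac{N-1}{N}\,(1-e^{-\sigma_e^2})^2\Bigl((1-e^{-\sigma_e^2})^2+2Ne^{-\sigma_e^2}\Bigr).$$ Then $\mathbb E[G_N]=\mu_N$ and $\operatorname{var}(G_N)=s_N^2$ for every $N\ge 1$, and $G_N$ is asymptotically Gaussian with this mean and variance: as $N\to\infty$, $$\frac{G_N-\mu_N}{s_N}\ \longrightarrow\ \mathcal N(0,1)\quad\text{in distribution.}$$ -/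

import Mathlib

open MeasureTheory ProbabilityTheory Filter
open scoped NNReal

noncomputable section

/-- The beamforming gain `G = (1/N) |∑ₙ exp(j φₙ)|²` of `N` equal-amplitude radios whose combining
phase errors are `φ₁, …, φ_N`. -/
def bfGain {N : ℕ} (φ : Fin N → ℝ) : ℝ :=
  (1 / (N : ℝ)) * ‖∑ n, Complex.exp (Complex.I * (φ n : ℂ))‖ ^ 2

/-- The mean `1 + (N - 1) e^{-v}`; `v` stands for the phase error variance `σₑ²`. -/
def gainMean (N : ℕ) (v : ℝ) : ℝ :=
  1 + ((N : ℝ) - 1) * Real.exp (-v)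

/-- The variance `((N - 1)/N) (1 - e^{-v})² ((1 - e^{-v})² + 2 N e^{-v})`; `v` stands for the
phase error variance `σₑ²`. -/
def gainVar (N : ℕ) (v : ℝ) : ℝ :=
  ((N : ℝ) - 1) / N * (1 - Real.exp (-v)) ^ 2 *
    ((1 - Real.exp (-v)) ^ 2 + 2 * N * Real.exp (-v))

end

/-! Put a = e^{-v/2}, the mean of cos φ, and q = a² = e^{-v}; let c = cos φ - a and s = sin φ, both
centered and uncorrelated under the Gaussian law. Expanding |∑ e^{jφ}|² around its mean direction
gives (∑ c + N a)² + (∑ s)². Since c² + s² = 1 - q - 2 a c, the diagonal of the quadratic part is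
affine in c and merges with the linear term. Hence G_N - μ_N is exactly a linear statistic in c plus
an off-diagonal quadratic form (`bfGain_eq`).

The linear and off-diagonal parts are orthogonal in L², so the second moment is explicit
(`integral_quadStat_sq`); this yields the variance. The linear part has variance of order N, the
off-diagonal part only of order 1.

The central limit theorem handles the normalized sum of the c's. Its difference from the
standardized gain is again a `quadStat`, so the same second moment formula shows that it tends to 0
in L², hence in probability, and Slutsky's theorem concludes. This is done for a single i.i.d.
sequence and carried over to the triangular array, since only the law of each row matters. -/

/-- A linear statistic plus the off-diagonal part of a quadratic one: with `A = ∑ f (pᵢ)` and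
`B = ∑ g (pᵢ)`, this is `α A + β ∑_{i ≠ j} (f (pᵢ) f (pⱼ) + g (pᵢ) g (pⱼ))`. -/
def quadStat (f g : ℝ → ℝ) (α β : ℝ) {n : ℕ} (p : Fin n → ℝ) : ℝ :=
  α * ∑ i, f (p i) + β * ((∑ i, f (p i)) ^ 2 + (∑ i, g (p i)) ^ 2
    - ∑ i, (f (p i) ^ 2 + g (p i) ^ 2))

/-! ### Moments of linear plus off-diagonal quadratic statistics under a product measure. -/

section

variable {μ : Measure ℝ} [IsProbabilityMeasure μ] {f g : ℝ → ℝ}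

lemma integral_pi_fin_succ {n : ℕ} (F : ℝ → (Fin n → ℝ) → ℝ) :
    ∫ p, F (p 0) (fun i => p i.succ) ∂Measure.pi (fun _ : Fin (n + 1) => μ)
      = ∫ z, F z.1 z.2 ∂(μ.prod (Measure.pi (fun _ : Fin n => μ))) := by
  have h := (measurePreserving_piFinSuccAbove (fun _ : Fin (n + 1) => μ) 0).integral_comp'
    (fun z => F z.1 z.2)
  rw [← h]
  rfl

/-- Essentially bounded functions are closed under products, so boundedness of `f` and `g` settles
every integrability question for polynomials in them. -/
lemma MeasureTheory.MemLp.mul_top {Ω : Type*} [MeasurableSpace Ω] {P : Measure Ω} {F G : Ω → ℝ}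
    (hF : MemLp F ⊤ P) (hG : MemLp G ⊤ P) : MemLp (fun ω => F ω * G ω) ⊤ P :=
  MemLp.mul' hG hF

lemma MeasureTheory.MemLp.sq_top {Ω : Type*} [MeasurableSpace Ω] {P : Measure Ω} {F : Ω → ℝ}
    (hF : MemLp F ⊤ P) : MemLp (fun ω => F ω ^ 2) ⊤ P := by
  simpa only [sq] using hF.mul_top hF

lemma memLp_top_sum_pi (hf : MemLp f ⊤ μ) (n : ℕ) :
    MemLp (fun p : Fin n → ℝ => ∑ i, f (p i)) ⊤ (Measure.pi (fun _ : Fin n => μ)) :=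
  memLp_finsetSum _ fun i _ =>
    hf.comp_measurePreserving (measurePreserving_eval (fun _ : Fin n => μ) i)

lemma memLp_top_quadStat (hf : MemLp f ⊤ μ) (hg : MemLp g ⊤ μ) (α β : ℝ) (n : ℕ) :
    MemLp (fun p : Fin n → ℝ => quadStat f g α β p) ⊤ (Measure.pi (fun _ : Fin n => μ)) :=
  ((memLp_top_sum_pi hf n).const_mul α).add
    ((((memLp_top_sum_pi hf n).sq_top.add (memLp_top_sum_pi hg n).sq_top).sub
      (memLp_top_sum_pi (f := fun x => f x ^ 2 + g x ^ 2) (hf.sq_top.add hg.sq_top) n)).const_mul β)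

lemma MeasureTheory.MemLp.integrable_prod_mul_top {E : Type*} [MeasurableSpace E]
    {ν : Measure E} [IsProbabilityMeasure ν] {h : ℝ → ℝ} {H : E → ℝ} (hh : MemLp h ⊤ μ)
    (hH : MemLp H ⊤ ν) :
    Integrable (fun z : ℝ × E => h z.1 * H z.2) (μ.prod ν) :=
  (hh.integrable le_top).mul_prod (hH.integrable le_top)

lemma integral_sum_pi (hf : MemLp f ⊤ μ) (hf0 : ∫ x, f x ∂μ = 0) (n : ℕ) :
    ∫ p, ∑ i, f (p i) ∂Measure.pi (fun _ : Fin n => μ) = 0 := by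
  rw [integral_finsetSum]
  · refine Finset.sum_eq_zero fun i _ => ?_
    rw [← hf0]
    exact integral_comp_eval (μ := fun _ : Fin n => μ) (i := i) (f := f) hf.aestronglyMeasurable
  · intro i _
    exact (hf.comp_measurePreserving
      (measurePreserving_eval (fun _ : Fin n => μ) i)).integrable le_top

lemma integral_sum_sq_pi (hf : MemLp f ⊤ μ) (hf0 : ∫ x, f x ∂μ = 0) (n : ℕ) :
    ∫ p, (∑ i, f (p i)) ^ 2 ∂Measure.pi (fun _ : Fin n => μ) = n * ∫ x, f x ^ 2 ∂μ := by
  induction n with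
  | zero => simp
  | succ n ih =>
    have h1 : MemLp (fun _ : ℝ => (1 : ℝ)) ⊤ μ := memLp_const _
    have h1' : MemLp (fun _ : Fin n → ℝ => (1 : ℝ)) ⊤ (Measure.pi (fun _ : Fin n => μ)) :=
      memLp_const _
    have hA := memLp_top_sum_pi hf n
    have i1 := h1.integrable_prod_mul_top hA.sq_top
    have i2 := (hf.integrable_prod_mul_top hA).const_mul 2
    have i3 := hf.sq_top.integrable_prod_mul_top h1'
    simp only [Fin.sum_univ_succ]
    rw [integral_pi_fin_succ (μ := μ) (fun x p => (f x + ∑ i, f (p i)) ^ 2)]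
    -- The factors `1` bring each term to the form (function of `z.1`) · (function of `z.2`), whose
    -- integral factors.
    calc _ = ∫ z : ℝ × (Fin n → ℝ), (1 * (∑ i, f (z.2 i)) ^ 2
            + 2 * (f z.1 * ∑ i, f (z.2 i))) + f z.1 ^ 2 * 1
            ∂(μ.prod (Measure.pi (fun _ : Fin n => μ))) := by
          congr 1; ext z; ring
      _ = _ := by
          rw [integral_add (i1.fun_add i2) i3, integral_add i1 i2,
            integral_prod_mul (fun _ => (1 : ℝ)) (fun p : Fin n → ℝ => (∑ i, f (p i)) ^ 2),
            integral_const_mul,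
            integral_prod_mul f (fun p : Fin n → ℝ => ∑ i, f (p i)),
            integral_prod_mul (fun x => f x ^ 2) (fun p : Fin n → ℝ => (1 : ℝ)), ih, hf0]
          simp
          ring

/-- With the diagonal removed, the squares of the new variable cancel. The increment is linear in `f
(p 0)` and `g (p 0)`, with coefficients depending on the other variables only: a martingale
difference when `f` and `g` are centered. -/
lemma quadStat_succ (α β : ℝ) {n : ℕ} (p : Fin (n + 1) → ℝ) :
    quadStat f g α β p = quadStat f g α β (fun i => p i.succ) + f (p 0) * α
      + 2 * β * (f (p 0) * ∑ i : Fin n, f (p i.succ) + g (p 0) * ∑ i : Fin n, g (p i.succ)) := by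
  simp only [quadStat, Fin.sum_univ_succ]
  ring

lemma integral_quadStat (hf : MemLp f ⊤ μ) (hg : MemLp g ⊤ μ) (hf0 : ∫ x, f x ∂μ = 0)
    (hg0 : ∫ x, g x ∂μ = 0) (α β : ℝ) (n : ℕ) :
    ∫ p, quadStat f g α β p ∂Measure.pi (fun _ : Fin n => μ) = 0 := by
  have hA := memLp_top_sum_pi hf n
  have hB := memLp_top_sum_pi hg n
  have hS := memLp_top_sum_pi (f := fun x => f x ^ 2 + g x ^ 2) (hf.sq_top.add hg.sq_top) n
  have hD : ∫ p, ∑ i, (f (p i) ^ 2 + g (p i) ^ 2) ∂Measure.pi (fun _ : Fin n => μ)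
      = n * (∫ x, f x ^ 2 ∂μ + ∫ x, g x ^ 2 ∂μ) := by
    rw [integral_finsetSum]
    · rw [← integral_add (hf.sq_top.integrable le_top) (hg.sq_top.integrable le_top)]
      simp_rw [integral_comp_eval (μ := fun _ : Fin n => μ)
        (f := fun x => f x ^ 2 + g x ^ 2) (hf.sq_top.add hg.sq_top).aestronglyMeasurable]
      simp
    · intro i _
      exact ((hf.sq_top.add hg.sq_top).comp_measurePreserving
        (measurePreserving_eval (fun _ : Fin n => μ) i)).integrable le_top
  have i1 := (hA.sq_top.integrable le_top).fun_add (hB.sq_top.integrable le_top)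
  have i2 : Integrable (fun p : Fin n → ℝ => (∑ i, f (p i)) ^ 2 + (∑ i, g (p i)) ^ 2
      - ∑ i, (f (p i) ^ 2 + g (p i) ^ 2)) (Measure.pi (fun _ : Fin n => μ)) :=
    i1.sub (hS.integrable le_top)
  unfold quadStat
  rw [integral_add ((hA.integrable le_top).const_mul α) (i2.const_mul β), integral_const_mul,
    integral_const_mul, integral_sub i1 (hS.integrable le_top),
    integral_add (hA.sq_top.integrable le_top) (hB.sq_top.integrable le_top),
    integral_sum_pi hf hf0, integral_sum_sq_pi hf hf0, integral_sum_sq_pi hg hg0, hD]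
  ring

/-- Induction on the number of variables: the increment of `quadStat_succ` is orthogonal to the
previous statistic because `f` and `g` have mean zero, and its own `f`-`g` cross term dies because
they are uncorrelated. What remains is the sum of the squared increments. -/
lemma integral_quadStat_sq (hf : MemLp f ⊤ μ) (hg : MemLp g ⊤ μ) (hf0 : ∫ x, f x ∂μ = 0)
    (hg0 : ∫ x, g x ∂μ = 0) (hfg : ∫ x, f x * g x ∂μ = 0) (α β : ℝ) (n : ℕ) :
    ∫ p, quadStat f g α β p ^ 2 ∂Measure.pi (fun _ : Fin n => μ)
      = n * α ^ 2 * ∫ x, f x ^ 2 ∂μ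
        + 2 * β ^ 2 * (n * (n - 1)) * ((∫ x, f x ^ 2 ∂μ) ^ 2 + (∫ x, g x ^ 2 ∂μ) ^ 2) := by
  induction n with
  | zero => simp [quadStat]
  | succ n ih =>
    have h1 : MemLp (fun _ : ℝ => (1 : ℝ)) ⊤ μ := memLp_const _
    have hA := memLp_top_sum_pi hf n
    have hB := memLp_top_sum_pi hg n
    have hQ := memLp_top_quadStat hf hg α β n
    have hL : MemLp (fun p : Fin n → ℝ => α + 2 * β * ∑ i, f (p i)) ⊤
      (Measure.pi (fun _ : Fin n => μ)) := (memLp_const α).add (hA.const_mul (2 * β))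
    have i1 := h1.integrable_prod_mul_top hQ.sq_top
    have i2 := (hf.integrable_prod_mul_top (hQ.mul_top hL)).const_mul 2
    have i3 := (hg.integrable_prod_mul_top (hQ.mul_top hB)).const_mul (4 * β)
    have i4 := hf.sq_top.integrable_prod_mul_top hL.sq_top
    have i5 := ((hf.mul_top hg).integrable_prod_mul_top (hL.mul_top hB)).const_mul (4 * β)
    have i6 := (hg.sq_top.integrable_prod_mul_top hB.sq_top).const_mul (4 * β ^ 2)
    have hL2 : ∫ p : Fin n → ℝ, (α + 2 * β * ∑ i, f (p i)) ^ 2 ∂Measure.pi (fun _ : Fin n => μ)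
        = α ^ 2 + 4 * β ^ 2 * (n * ∫ x, f x ^ 2 ∂μ) := by
      have j1 : Integrable (fun _ : Fin n → ℝ => α ^ 2) (Measure.pi (fun _ : Fin n => μ)) :=
        integrable_const _
      have j2 := (hA.integrable le_top).const_mul (4 * α * β)
      have j3 := (hA.sq_top.integrable le_top).const_mul (4 * β ^ 2)
      calc _ = ∫ p : Fin n → ℝ, (α ^ 2 + 4 * α * β * ∑ i, f (p i))
              + 4 * β ^ 2 * (∑ i, f (p i)) ^ 2 ∂Measure.pi (fun _ : Fin n => μ) := by
            congr 1; ext p; ring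
        _ = _ := by
            rw [integral_add (j1.fun_add j2) j3, integral_add j1 j2, integral_const_mul,
              integral_const_mul, integral_sum_pi hf hf0, integral_sum_sq_pi hf hf0]
            simp
    simp only [quadStat_succ]
    rw [integral_pi_fin_succ (μ := μ) (fun x p => (quadStat f g α β p + f x * α
      + 2 * β * (f x * ∑ i : Fin n, f (p i) + g x * ∑ i : Fin n, g (p i))) ^ 2)]
    calc _ = ∫ z : ℝ × (Fin n → ℝ), ((((1 * quadStat f g α β z.2 ^ 2
            + 2 * (f z.1 * (quadStat f g α β z.2 * (α + 2 * β * ∑ i, f (z.2 i)))))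
            + 4 * β * (g z.1 * (quadStat f g α β z.2 * ∑ i, g (z.2 i))))
            + f z.1 ^ 2 * (α + 2 * β * ∑ i, f (z.2 i)) ^ 2)
            + 4 * β * ((f z.1 * g z.1) * ((α + 2 * β * ∑ i, f (z.2 i)) * ∑ i, g (z.2 i))))
            + 4 * β ^ 2 * (g z.1 ^ 2 * (∑ i, g (z.2 i)) ^ 2)
            ∂(μ.prod (Measure.pi (fun _ : Fin n => μ))) := by
          congr 1; ext z; ring
      _ = _ := by
          rw [integral_add ((((i1.fun_add i2).fun_add i3).fun_add i4).fun_add i5) i6,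
            integral_add (((i1.fun_add i2).fun_add i3).fun_add i4) i5,
            integral_add ((i1.fun_add i2).fun_add i3) i4, integral_add (i1.fun_add i2) i3,
            integral_add i1 i2,
            integral_prod_mul (fun _ => (1 : ℝ)) (fun p : Fin n → ℝ => quadStat f g α β p ^ 2),
            integral_const_mul, integral_const_mul, integral_const_mul, integral_const_mul,
            integral_prod_mul f
              (fun p : Fin n → ℝ => quadStat f g α β p * (α + 2 * β * ∑ i, f (p i))),
            integral_prod_mul g (fun p : Fin n → ℝ => quadStat f g α β p * ∑ i, g (p i)),
            integral_prod_mul (fun x => f x ^ 2)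
              (fun p : Fin n → ℝ => (α + 2 * β * ∑ i, f (p i)) ^ 2),
            integral_prod_mul (fun x => f x * g x)
              (fun p : Fin n → ℝ => (α + 2 * β * ∑ i, f (p i)) * ∑ i, g (p i)),
            integral_prod_mul (fun x => g x ^ 2) (fun p : Fin n → ℝ => (∑ i, g (p i)) ^ 2),
            ih, hf0, hg0, hfg, hL2, integral_sum_sq_pi hg hg0]
          simp
          ring

end

/-! ### Trigonometric moments of a Gaussian phase and the decomposition of the gain. -/

section

variable (v : ℝ≥0)

lemma integral_cexp_mul_I_gaussianReal (t : ℝ) :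
    ∫ x : ℝ, Complex.exp (t * x * Complex.I) ∂gaussianReal 0 v
      = (Real.exp (-(v * t ^ 2 / 2)) : ℝ) := by
  rw [← charFun_apply_real, charFun_gaussianReal]
  push_cast
  congr 1
  simp

lemma integrable_cexp_mul_I_gaussianReal (t : ℝ) :
    Integrable (fun x : ℝ => Complex.exp (t * x * Complex.I)) (gaussianReal 0 v) := by
  refine Integrable.of_bound (by fun_prop) 1 (ae_of_all _ fun x => ?_)
  rw [← Complex.ofReal_mul, Complex.norm_exp_ofReal_mul_I]

/-- Real part of the characteristic function; the sine integral is its imaginary part. -/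
lemma integral_cos_mul_gaussianReal (t : ℝ) :
    ∫ x, Real.cos (t * x) ∂gaussianReal 0 v = Real.exp (-(v * t ^ 2 / 2)) := by
  have h := congrArg Complex.re (integral_cexp_mul_I_gaussianReal v t)
  rw [Complex.ofReal_re, ← RCLike.re_eq_complex_re,
    ← integral_re (integrable_cexp_mul_I_gaussianReal v t)] at h
  rw [← h]
  congr 1; ext x
  rw [RCLike.re_eq_complex_re, ← Complex.ofReal_mul, Complex.exp_ofReal_mul_I_re]

lemma integral_sin_mul_gaussianReal (t : ℝ) :
    ∫ x, Real.sin (t * x) ∂gaussianReal 0 v = 0 := by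
  have h := congrArg Complex.im (integral_cexp_mul_I_gaussianReal v t)
  rw [Complex.ofReal_im, ← RCLike.im_eq_complex_im,
    ← integral_im (integrable_cexp_mul_I_gaussianReal v t)] at h
  refine Eq.trans ?_ h
  refine integral_congr_ae (ae_of_all _ fun x => ?_)
  dsimp only
  rw [RCLike.im_eq_complex_im, ← Complex.ofReal_mul, Complex.exp_ofReal_mul_I_im]

/-- The cosine centered under the Gaussian law of variance `v`. -/
noncomputable def centeredCos (x : ℝ) : ℝ := Real.cos x - Real.exp (-v / 2)

lemma memLp_sin_gaussianReal : MemLp Real.sin ⊤ (gaussianReal 0 v) :=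
  memLp_top_of_bound (by fun_prop) 1 (ae_of_all _ fun x => Real.abs_sin_le_one x)

lemma memLp_cos_gaussianReal : MemLp Real.cos ⊤ (gaussianReal 0 v) :=
  memLp_top_of_bound (by fun_prop) 1 (ae_of_all _ fun x => Real.abs_cos_le_one x)

lemma memLp_centeredCos : MemLp (centeredCos v) ⊤ (gaussianReal 0 v) :=
  (memLp_cos_gaussianReal v).sub (memLp_const _)

lemma continuous_centeredCos : Continuous (centeredCos v) := by
  unfold centeredCos; fun_prop

lemma integral_sin_gaussianReal : ∫ x, Real.sin x ∂gaussianReal 0 v = 0 := by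
  simpa using integral_sin_mul_gaussianReal v 1

lemma integral_cos_gaussianReal :
    ∫ x, Real.cos x ∂gaussianReal 0 v = Real.exp (-v / 2) := by
  simpa [neg_div] using integral_cos_mul_gaussianReal v 1

lemma integral_cos_two_mul_gaussianReal :
    ∫ x, Real.cos (2 * x) ∂gaussianReal 0 v = Real.exp (-v) ^ 2 := by
  rw [integral_cos_mul_gaussianReal, ← Real.exp_nat_mul]
  congr 1
  push_cast; ring

lemma integrable_cos_two_mul_gaussianReal :
    Integrable (fun x => Real.cos (2 * x)) (gaussianReal 0 v) :=
  Integrable.of_bound (by fun_prop) 1 (ae_of_all _ fun x => Real.abs_cos_le_one _)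

lemma integrable_sin_two_mul_gaussianReal :
    Integrable (fun x => Real.sin (2 * x)) (gaussianReal 0 v) :=
  Integrable.of_bound (by fun_prop) 1 (ae_of_all _ fun x => Real.abs_sin_le_one _)

lemma exp_neg_half_sq : Real.exp (-(v : ℝ) / 2) ^ 2 = Real.exp (-v) := by
  rw [← Real.exp_nat_mul]; congr 1; push_cast; ring

lemma integral_centeredCos : ∫ x, centeredCos v x ∂gaussianReal 0 v = 0 := by
  unfold centeredCos
  rw [integral_sub ((memLp_cos_gaussianReal v).integrable le_top) (integrable_const _),
    integral_cos_gaussianReal]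
  simp

lemma integral_centeredCos_mul_sin :
    ∫ x, centeredCos v x * Real.sin x ∂gaussianReal 0 v = 0 := by
  have h : (fun x => centeredCos v x * Real.sin x) = fun x => 1 / 2 * Real.sin (2 * x)
      - Real.exp (-v / 2) * Real.sin x := by
    ext x; rw [centeredCos, Real.sin_two_mul]; ring
  rw [h, integral_sub ((integrable_sin_two_mul_gaussianReal v).const_mul _)
    (((memLp_sin_gaussianReal v).integrable le_top).const_mul _), integral_const_mul,
    integral_const_mul, integral_sin_gaussianReal, integral_sin_mul_gaussianReal]
  simp

lemma integral_sin_sq_gaussianReal :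
    ∫ x, Real.sin x ^ 2 ∂gaussianReal 0 v = (1 - Real.exp (-v) ^ 2) / 2 := by
  have h : (fun x => Real.sin x ^ 2) = fun x => 1 / 2 - 1 / 2 * Real.cos (2 * x) := by
    ext x; rw [Real.cos_two_mul, Real.cos_sq']; ring
  rw [h, integral_sub (integrable_const _) ((integrable_cos_two_mul_gaussianReal v).const_mul _),
    integral_const_mul, integral_cos_two_mul_gaussianReal]
  simp; ring

lemma integral_centeredCos_sq :
    ∫ x, centeredCos v x ^ 2 ∂gaussianReal 0 v = (1 - Real.exp (-v)) ^ 2 / 2 := by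
  have h : (fun x => centeredCos v x ^ 2) = fun x => 1 / 2 * Real.cos (2 * x)
      + (1 / 2 + Real.exp (-v) - 2 * Real.exp (-v / 2) * Real.cos x) := by
    ext x; rw [centeredCos, Real.cos_two_mul, ← exp_neg_half_sq]; ring
  have i2 := ((memLp_cos_gaussianReal v).integrable le_top).const_mul (2 * Real.exp (-(v : ℝ) / 2))
  have i3 : Integrable (fun x => 1 / 2 + Real.exp (-(v : ℝ))
      - 2 * Real.exp (-(v : ℝ) / 2) * Real.cos x) (gaussianReal 0 v) :=
    (integrable_const _).sub i2
  rw [h, integral_add ((integrable_cos_two_mul_gaussianReal v).const_mul _)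
    i3, integral_sub (integrable_const _) i2,
    integral_const_mul, integral_const_mul, integral_cos_two_mul_gaussianReal,
    integral_cos_gaussianReal, mul_assoc, ← sq, exp_neg_half_sq]
  simp; ring

/-- The mean square of `quadStat` for the centered cosine and the sine of Gaussian phases. -/
lemma integral_quadStat_centeredCos_sin_sq (α β : ℝ) (n : ℕ) :
    ∫ p, quadStat (centeredCos v) Real.sin α β p ^ 2
        ∂Measure.pi (fun _ : Fin n => gaussianReal 0 v)
      = n * α ^ 2 * ((1 - Real.exp (-v)) ^ 2 / 2)
        + β ^ 2 * (n * (n - 1)) * ((1 - Real.exp (-v)) ^ 2 * (1 + Real.exp (-v) ^ 2)) := by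
  rw [integral_quadStat_sq (memLp_centeredCos v) (memLp_sin_gaussianReal v)
    (integral_centeredCos v) (integral_sin_gaussianReal v) (integral_centeredCos_mul_sin v),
    integral_sin_sq_gaussianReal, integral_centeredCos_sq]
  ring

/-- The linear coefficient collects `2 a` from the cross term of `(∑ c + N a)²` and `-2 a / N` from
the diagonal, where `c² + s² = 1 - a² - 2 a c` by `cos² + sin² = 1`; here `a = exp (-v / 2)`. -/
lemma bfGain_eq {N : ℕ} (hN : 1 ≤ N) (p : Fin N → ℝ) :
    bfGain p = gainMean N v + quadStat (centeredCos v) Real.sin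
      (2 * Real.exp (-v / 2) * (N - 1) / N) (1 / N) p := by
  have hN' : (N : ℝ) ≠ 0 := by positivity
  have hnorm : ‖∑ n, Complex.exp (Complex.I * (p n : ℂ))‖ ^ 2
      = (∑ i, Real.cos (p i)) ^ 2 + (∑ i, Real.sin (p i)) ^ 2 := by
    rw [← Complex.normSq_eq_norm_sq, Complex.normSq_apply, Complex.re_sum, Complex.im_sum]
    simp_rw [mul_comm Complex.I, Complex.exp_ofReal_mul_I_re, Complex.exp_ofReal_mul_I_im]
    ring
  have hA : ∑ i, Real.cos (p i) = ∑ i, centeredCos v (p i) + N * Real.exp (-v / 2) := by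
    simp [centeredCos]
  have hD : ∑ i, (centeredCos v (p i) ^ 2 + Real.sin (p i) ^ 2)
      = N * (1 - Real.exp (-v)) - 2 * Real.exp (-v / 2) * ∑ i, centeredCos v (p i) := by
    have : ∀ i, centeredCos v (p i) ^ 2 + Real.sin (p i) ^ 2
        = (1 - Real.exp (-v)) - 2 * Real.exp (-v / 2) * centeredCos v (p i) := fun i => by
      rw [centeredCos, Real.sin_sq, ← exp_neg_half_sq]; ring
    simp_rw [this, Finset.sum_sub_distrib, ← Finset.mul_sum]
    simp [mul_sub]
  rw [bfGain, quadStat, gainMean, hnorm, hA, hD, ← exp_neg_half_sq]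
  field_simp
  ring

end

/-! ### Mean and variance of the gain; convergence in probability from second moments. -/

section

variable {v : ℝ≥0} {Ω : Type*} [MeasurableSpace Ω] {P : Measure Ω}

lemma measurable_bfGain (N : ℕ) : Measurable (fun p : Fin N → ℝ => bfGain p) := by
  unfold bfGain
  fun_prop

lemma aemeasurable_bfGain {N : ℕ} {ξ : Ω → Fin N → ℝ}
    (hξ : HasLaw ξ (Measure.pi fun _ => gaussianReal 0 v) P) :
    AEMeasurable (fun ω => bfGain (ξ ω)) P :=
  (measurable_bfGain N).comp_aemeasurable hξ.aemeasurable

lemma integral_quadStat_comp_sq {N : ℕ} {ξ : Ω → Fin N → ℝ}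
    (hξ : HasLaw ξ (Measure.pi fun _ => gaussianReal 0 v) P) (α β : ℝ) :
    ∫ ω, quadStat (centeredCos v) Real.sin α β (ξ ω) ^ 2 ∂P
      = N * α ^ 2 * ((1 - Real.exp (-v)) ^ 2 / 2)
        + β ^ 2 * (N * (N - 1)) * ((1 - Real.exp (-v)) ^ 2 * (1 + Real.exp (-v) ^ 2)) := by
  rw [← integral_quadStat_centeredCos_sin_sq]
  exact hξ.integral_comp (f := fun p => quadStat (centeredCos v) Real.sin α β p ^ 2)
    (memLp_top_quadStat (memLp_centeredCos v) (memLp_sin_gaussianReal v) α β N).sq_top.1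

lemma integrable_quadStat_comp_sq {N : ℕ} {ξ : Ω → Fin N → ℝ}
    (hξ : HasLaw ξ (Measure.pi fun _ => gaussianReal 0 v) P) (α β : ℝ) :
    Integrable (fun ω => quadStat (centeredCos v) Real.sin α β (ξ ω) ^ 2) P := by
  have h := (memLp_top_quadStat (memLp_centeredCos v) (memLp_sin_gaussianReal v)
    α β N).sq_top.integrable le_top
  rw [← hξ.map_eq] at h
  exact h.comp_aemeasurable hξ.aemeasurable

lemma integral_bfGain {N : ℕ} (hN : 1 ≤ N) {ξ : Ω → Fin N → ℝ}
    (hξ : HasLaw ξ (Measure.pi fun _ => gaussianReal 0 v) P) :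
    ∫ ω, bfGain (ξ ω) ∂P = gainMean N v := by
  have hQ := memLp_top_quadStat (memLp_centeredCos v) (memLp_sin_gaussianReal v)
    (2 * Real.exp (-v / 2) * (N - 1) / N) (1 / N) N
  have h := hξ.integral_comp (f := fun p => bfGain p) (measurable_bfGain N).aestronglyMeasurable
  simp only [Function.comp_def] at h
  rw [h]
  simp_rw [bfGain_eq v hN]
  rw [integral_add (integrable_const _) (hQ.integrable le_top),
    integral_quadStat (memLp_centeredCos v) (memLp_sin_gaussianReal v) (integral_centeredCos v)
      (integral_sin_gaussianReal v)]
  simp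

lemma variance_bfGain {N : ℕ} (hN : 1 ≤ N) {ξ : Ω → Fin N → ℝ}
    (hξ : HasLaw ξ (Measure.pi fun _ => gaussianReal 0 v) P) :
    variance (fun ω => bfGain (ξ ω)) P = gainVar N v := by
  have hN' : (N : ℝ) ≠ 0 := by positivity
  rw [variance_eq_integral (aemeasurable_bfGain hξ), integral_bfGain hN hξ]
  simp_rw [bfGain_eq v hN, add_sub_cancel_left]
  rw [integral_quadStat_comp_sq hξ, gainVar]
  have h := exp_neg_half_sq v
  generalize Real.exp (-(v : ℝ) / 2) = a at h ⊢
  rw [← h]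
  field_simp
  ring

/-- Chebyshev's inequality. -/
lemma tendstoInMeasure_zero_of_integral_sq [IsProbabilityMeasure P] {D : ℕ → Ω → ℝ}
    (hD : ∀ᶠ N in atTop, Integrable (fun ω => D N ω ^ 2) P)
    (h : Tendsto (fun N => ∫ ω, D N ω ^ 2 ∂P) atTop (nhds 0)) :
    TendstoInMeasure P D atTop 0 := by
  rw [tendstoInMeasure_iff_measureReal_norm]
  intro ε hε
  have h' := h.div_const (ε ^ 2)
  rw [zero_div] at h'
  refine squeeze_zero' (.of_forall fun _ => measureReal_nonneg) ?_ h'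
  filter_upwards [hD] with N hN
  rw [le_div_iff₀ (by positivity), mul_comm]
  refine le_trans (le_of_eq ?_)
    (mul_meas_ge_le_integral_of_nonneg (ae_of_all _ fun ω => sq_nonneg (D N ω)) hN (ε ^ 2))
  congr 2
  ext ω
  simp only [Pi.zero_apply, sub_zero, Set.mem_ofPred_eq, Real.norm_eq_abs]
  rw [← sq_abs (D N ω), sq_le_sq₀ hε.le (abs_nonneg _)]

end

/-! ### Asymptotics of the coefficients and the central limit theorem. -/

lemma exp_neg_lt_one {v : ℝ≥0} (hv : 0 < v) : Real.exp (-(v : ℝ)) < 1 := by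
  have : (0 : ℝ) < v := hv
  rw [Real.exp_lt_one_iff]; linarith

/-- One radio is excluded: its gain is constantly 1, with variance 0. -/
lemma gainVar_pos {v : ℝ≥0} (hv : 0 < v) {N : ℕ} (hN : 2 ≤ N) : 0 < gainVar N v := by
  have hq := exp_neg_lt_one hv
  have hq0 := Real.exp_pos (-(v : ℝ))
  have hN' : (2 : ℝ) ≤ N := by exact_mod_cast hN
  have : 0 < 1 - Real.exp (-(v : ℝ)) := by linarith
  have : 0 < (N : ℝ) - 1 := by linarith
  unfold gainVar
  positivity

/-- The squared ratio of the standard deviations of the linear part of the gain and of the gain. -/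
noncomputable def linearRatio (v : ℝ≥0) (N : ℕ) : ℝ :=
  2 * Real.exp (-v) * (N - 1) / ((1 - Real.exp (-v)) ^ 2 + 2 * N * Real.exp (-v))

lemma tendsto_natCast_mul_add_atTop (v : ℝ≥0) :
    Tendsto (fun N : ℕ => (1 - Real.exp (-(v : ℝ))) ^ 2 + 2 * N * Real.exp (-v)) atTop atTop := by
  refine tendsto_atTop_add_const_left _ _ ?_
  refine Tendsto.atTop_mul_const (Real.exp_pos _) ?_
  exact tendsto_natCast_atTop_atTop.const_mul_atTop (by norm_num)

lemma tendsto_linearRatio {v : ℝ≥0} (hv : 0 < v) : Tendsto (linearRatio v) atTop (nhds 1) := by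
  have h1q : 0 < 1 - Real.exp (-(v : ℝ)) := sub_pos.2 (exp_neg_lt_one hv)
  have h : linearRatio v = fun N : ℕ => 1 - ((1 - Real.exp (-(v : ℝ))) ^ 2 + 2 * Real.exp (-v))
      / ((1 - Real.exp (-(v : ℝ))) ^ 2 + 2 * N * Real.exp (-v)) := by
    ext N
    have : (1 - Real.exp (-(v : ℝ))) ^ 2 + 2 * N * Real.exp (-v) ≠ 0 := by positivity
    rw [linearRatio, eq_sub_iff_add_eq, ← add_div, div_eq_one_iff_eq this]
    ring
  rw [h]
  simpa using (tendsto_const_nhds (x := (1 : ℝ))).sub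
    ((tendsto_natCast_mul_add_atTop v).const_div_atTop _)

/-- The linear part of the gain and the sum in the central limit theorem are multiples of the same
`∑ c`. Once standardized they have standard deviations `√(linearRatio v N)` and 1, so their
difference has variance the square of the gap. -/
lemma linear_coeff_sq {v : ℝ≥0} (hv : 0 < v) {N : ℕ} (hN : 2 ≤ N) :
    N * (2 * Real.exp (-v / 2) * (N - 1) / N / √(gainVar N v)
        - (√N)⁻¹ / √((1 - Real.exp (-v)) ^ 2 / 2)) ^ 2 * ((1 - Real.exp (-v)) ^ 2 / 2)
      = (√(linearRatio v N) - 1) ^ 2 := by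
  have hq := exp_neg_lt_one hv
  have hq0 := Real.exp_pos (-(v : ℝ))
  have ha := Real.exp_pos (-(v : ℝ) / 2)
  have hN' : (2 : ℝ) ≤ N := by exact_mod_cast hN
  have hN0 : (0 : ℝ) < N := by linarith
  have hN1 : 0 < (N : ℝ) - 1 := by linarith
  have h1q : 0 < 1 - Real.exp (-(v : ℝ)) := by linarith
  have hs := gainVar_pos hv hN
  have hx : 0 < (1 - Real.exp (-(v : ℝ))) ^ 2 / 2 := by positivity
  set x := (1 - Real.exp (-(v : ℝ))) ^ 2 / 2 with hxdef
  set c := 2 * Real.exp (-(v : ℝ) / 2) * (N - 1) / N with hc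
  have hc0 : 0 < c := by positivity
  have hr : √(linearRatio v N) = c * √N * √x / √(gainVar N v) := by
    rw [Real.sqrt_eq_iff_mul_self_eq_of_pos (by positivity), ← sq, div_pow, mul_pow, mul_pow, Real.sq_sqrt hN0.le,
      Real.sq_sqrt hx.le, Real.sq_sqrt hs.le, hc, hxdef, linearRatio, gainVar]
    have h := exp_neg_half_sq v
    rw [← h] at h1q hq0 ⊢
    generalize Real.exp (-(v : ℝ) / 2) = a at *
    field_simp
  rw [hr]
  have e : N * (c / √(gainVar N v) - (√N)⁻¹ / √x) ^ 2 * x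
      = (√N * √x * (c / √(gainVar N v) - (√N)⁻¹ / √x)) ^ 2 := by
    rw [mul_pow, mul_pow, Real.sq_sqrt hN0.le, Real.sq_sqrt hx.le]; ring
  rw [e]
  have hsN : √(N : ℝ) ≠ 0 := by positivity
  have hsx : √x ≠ 0 := by positivity
  congr 1
  field_simp

/-- Share of the off-diagonal part in the variance of the gain; the right side is of order `1 / N`.
-/
lemma quadratic_coeff_sq {v : ℝ≥0} (hv : 0 < v) {N : ℕ} (hN : 2 ≤ N) :
    (1 / N / √(gainVar N v)) ^ 2 * (N * (N - 1))
        * ((1 - Real.exp (-v)) ^ 2 * (1 + Real.exp (-v) ^ 2))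
      = (1 + Real.exp (-(v : ℝ)) ^ 2)
        / ((1 - Real.exp (-(v : ℝ))) ^ 2 + 2 * N * Real.exp (-v)) := by
  have hq := exp_neg_lt_one hv
  have hq0 := Real.exp_pos (-(v : ℝ))
  have hN' : (2 : ℝ) ≤ N := by exact_mod_cast hN
  have hN0 : (0 : ℝ) < N := by linarith
  have hN1 : 0 < (N : ℝ) - 1 := by linarith
  have h1q : 0 < 1 - Real.exp (-(v : ℝ)) := by linarith
  rw [div_pow, Real.sq_sqrt (gainVar_pos hv hN).le, gainVar]
  field_simp

lemma tendstoInDistribution_iid_bfGain {v : ℝ≥0} (hv : 0 < v) {Ω : Type*} [MeasurableSpace Ω]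
    {P : Measure Ω} [IsProbabilityMeasure P] {X : ℕ → Ω → ℝ}
    (hX : ∀ k, HasLaw (X k) (gaussianReal 0 v) P) (hind : iIndepFun X P) :
    TendstoInDistribution
      (fun (N : ℕ) ω => (bfGain (fun i : Fin N => X i ω) - gainMean N v) / √(gainVar N v))
      atTop (id : ℝ → ℝ) (fun _ => P) (gaussianReal 0 1) := by
  have hq := exp_neg_lt_one hv
  have h1q : 0 < 1 - Real.exp (-(v : ℝ)) := by linarith
  -- `x` is the variance of the centered cosine, so dividing by `√x` gives the unit variance that
  -- the central limit theorem needs.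
  set x := (1 - Real.exp (-(v : ℝ))) ^ 2 / 2 with hx
  have hx0 : 0 < x := by positivity
  have hlaw (N : ℕ) : HasLaw (fun ω (i : Fin N) => X i ω)
      (Measure.pi fun _ => gaussianReal 0 v) P :=
    iIndepFun.hasLaw_pi (fun i => hX i) (hind.precomp Fin.val_injective)
  have hcont : Continuous fun y => centeredCos v y / √x := (continuous_centeredCos v).div_const _
  have hclt := tendstoInDistribution_inv_sqrt_mul_sum (P := P)
    (X := fun k ω => centeredCos v (X k ω) / √x) (HasLaw.id (μ := gaussianReal 0 1)) ?_ ?_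
    (hind.comp (fun _ y => centeredCos v y / √x) fun _ => hcont.measurable)
    (fun k => (IdentDistrib.mk (hX k).aemeasurable (hX 0).aemeasurable
      ((hX k).map_eq.trans (hX 0).map_eq.symm)).comp hcont.measurable)
  · refine tendstoInDistribution_of_tendstoInMeasure_sub _ _ hclt ?_ fun N =>
      ((aemeasurable_bfGain (hlaw N)).sub_const _).div_const _
    -- Subtracting the normalized sum changes only the linear coefficient, so the error is again a
    -- `quadStat` with known second moment.
    have hD : ∀ᶠ N : ℕ in atTop, ∀ ω,
        (bfGain (fun i : Fin N => X i ω) - gainMean N v) / √(gainVar N v)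
          - (√N)⁻¹ * ∑ k ∈ Finset.range N, centeredCos v (X k ω) / √x
        = quadStat (centeredCos v) Real.sin
            (2 * Real.exp (-v / 2) * (N - 1) / N / √(gainVar N v) - (√N)⁻¹ / √x)
            (1 / N / √(gainVar N v)) (fun i : Fin N => X i ω) := by
      filter_upwards [eventually_ge_atTop 2] with N hN ω
      rw [bfGain_eq v (by omega), add_sub_cancel_left, ← Finset.sum_div,
        Finset.sum_range fun k => centeredCos v (X k ω), quadStat, quadStat]
      ring
    refine tendstoInMeasure_zero_of_integral_sq ?_ ?_
    · filter_upwards [hD] with N hN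
      simp only [Pi.sub_apply, hN]
      exact integrable_quadStat_comp_sq (hlaw N) _ _
    · have hlim : Tendsto (fun N : ℕ => (√(linearRatio v N) - 1) ^ 2
          + (1 + Real.exp (-(v : ℝ)) ^ 2)
            / ((1 - Real.exp (-(v : ℝ))) ^ 2 + 2 * N * Real.exp (-v))) atTop (nhds 0) := by
        have h1 := (((tendsto_linearRatio hv).sqrt).sub_const 1).pow 2
        simpa using h1.add
          ((tendsto_natCast_mul_add_atTop v).const_div_atTop (1 + Real.exp (-(v : ℝ)) ^ 2))
      refine hlim.congr' ?_
      filter_upwards [hD, eventually_ge_atTop 2] with N hN hN2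
      simp only [Pi.sub_apply, hN]
      rw [integral_quadStat_comp_sq (hlaw N), hx, linear_coeff_sq hv hN2,
        quadratic_coeff_sq hv hN2]
  · have h := (hX 0).integral_comp (f := fun y => centeredCos v y / √x) hcont.aestronglyMeasurable
    simp only [Function.comp_def] at h
    rw [h, integral_div, integral_centeredCos, zero_div]
  · have h := (hX 0).integral_comp (f := fun y => (centeredCos v y / √x) ^ 2)
      (hcont.pow 2).aestronglyMeasurable
    simp only [Function.comp_def] at h
    simp only [Pi.pow_apply]
    rw [h]
    simp_rw [div_pow]
    rw [integral_div, integral_centeredCos_sq, Real.sq_sqrt hx0.le, ← hx, div_self hx0.ne']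

theorem proposition3
    (v : ℝ≥0) (hv : 0 < v)
    {Ω : ℕ → Type*} [∀ N, MeasurableSpace (Ω N)]
    (P : (N : ℕ) → Measure (Ω N)) [∀ N, IsProbabilityMeasure (P N)]
    (φ : (N : ℕ) → Fin N → Ω N → ℝ)
    (hlaw : ∀ N n, HasLaw (φ N n) (gaussianReal 0 v) (P N))
    (hindep : ∀ N, iIndepFun (φ N) (P N)) :
    (∀ N : ℕ, 1 ≤ N →
      ∫ ω, bfGain (fun n => φ N n ω) ∂(P N) = gainMean N v ∧
      variance (fun ω => bfGain (fun n => φ N n ω)) (P N) = gainVar N v) ∧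
    TendstoInDistribution
      (fun (N : ℕ) (ω : Ω N) =>
        (bfGain (fun n => φ N n ω) - gainMean N v) / Real.sqrt (gainVar N v))
      atTop (id : ℝ → ℝ) P (gaussianReal 0 1) := by
  have hpi (N : ℕ) : HasLaw (fun ω n => φ N n ω) (Measure.pi fun _ => gaussianReal 0 v) (P N) :=
    (hindep N).hasLaw_pi (hlaw N)
  refine ⟨fun N hN => ⟨integral_bfGain hN (hpi N), variance_bfGain hN (hpi N)⟩, ?_⟩
  obtain ⟨Ω', _, P', X, -, hX, hXind, _⟩ := exists_iid ℕ (gaussianReal 0 v)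
  have h := tendstoInDistribution_iid_bfGain hv hX hXind
  have hstat (N : ℕ) : Measurable fun p : Fin N → ℝ =>
      (bfGain p - gainMean N v) / √(gainVar N v) :=
    ((measurable_bfGain N).sub_const _).div_const _
  refine ⟨fun N => (hstat N).comp_aemeasurable (hpi N).aemeasurable, aemeasurable_id, ?_⟩
  -- Convergence in distribution sees only the laws, and both statistics push forward the same
  -- product Gaussian measure on `Fin N → ℝ`.
  refine h.tendsto.congr fun N => Subtype.ext ?_
  have hXpi : HasLaw (fun ω (i : Fin N) => X i ω) (Measure.pi fun _ => gaussianReal 0 v) P' :=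
    iIndepFun.hasLaw_pi (fun i => hX i) (hXind.precomp Fin.val_injective)
  have e1 := AEMeasurable.map_map_of_aemeasurable (hstat N).aemeasurable hXpi.aemeasurable
  have e2 := AEMeasurable.map_map_of_aemeasurable (hstat N).aemeasurable (hpi N).aemeasurable
  rw [hXpi.map_eq] at e1
  rw [(hpi N).map_eq] at e2
  exact e1.symm.trans e2
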